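/- Let $\mathcal G$ be a connected, locally finite metric graph with countable vertex set $\mathcal V$ and edge set $\mathcal E$, each edge $e$ having a length $l_e\in(0,\infty)$ and being identified with $[0,l_e]$ (loops and multiple edges are allowed; a loop counts twice in the degree and contributes both of its ends below). Let $\partial\mathcal G\subseteq\mathcal V$ be a set of boundary vertices containing all vertices of degree $1$, and let $\mathcal G_{int}=\mathcal G\setminus\partial\mathcal G$; the vertices not in $\partial\mathcal G$ are called interior. Let $\overline{\mathcal G}$ be the completion of $\mathcal G$ for the geodesic distance (the infimum of the lengths of the paths joining two points), and let $\partial\overline{\mathcal G}=\overline{\mathcal G}\setminus\mathcal G_{int}$. Assume that $\overline{\mathcal G}$ is compact and that $\partial\overline{\mathcal G}$ is totally disconnected and nonempty. For $f:\overline{\mathcal G}\to\mathbb R$ let $f_e:[0,l_e]\to\mathbb R$ be its restriction to the edge $e$. Let $\mathbb H_1$ be the set of continuous functions $f:\overline{\mathcal G}\to\mathbb R$ such that each $f_e$ is absolutely continuous and $f'\in L^2(\mathcal G)=\bigoplus_{e}L^2[0,l_e]$, that is, $\sum_{e}\int_0^{l_e}(f_e')^2<\infty$. A continuous function $f:\overline{\mathcal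 G}\to\mathbb R$ is harmonic if $f_e''=0$ on each edge $e$ and, at each interior vertex $v$, $\sum_{e\sim v}\partial_\nu f_e(v)=0$, where $\partial_\nu f_e(v)$ is the derivative of $f_e$ at $v$ in the coordinate of $e$ pointing away from $v$. Let $H_{fin}$ be the set of harmonic functions that belong to $\mathbb H_1$. Let $\{E(n): n=1,\dots,N\}$ be a finite partition of $\partial\overline{\mathcal G}$ into sets that are clopen in $\partial\overline{\mathcal G}$, and let $F=\sum_{n=1}^N c_n 1_{E(n)}$ with $c_1,\dots,c_N\in\mathbb R$. Then there is a unique $f\in H_{fin}$ with $f=F$ on $\partial\overline{\mathcal G}$. -/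

import Mathlib

open Set MeasureTheory

/-- A connected, locally finite metric graph with a set of boundary vertices that contains all
vertices of degree one. Each edge `e` is identified with the interval `[0, len e]`, with `0`
placed at the vertex `src e` and `len e` at the vertex `tgt e`; the orientation is only a choice
of this identification. Loops and multiple edges are allowed. -/
structure MetricGraph (V E : Type*) where
  src : E → V
  tgt : E → V
  len : E → ℝ
  len_pos : ∀ e, 0 < len e
  finite_src : ∀ v, {e | src e = v}.Finite
  finite_tgt : ∀ v, {e | tgt e = v}.Finite
  connected : ∀ v w, Relation.ReflTransGen
    (fun a b => ∃ e, (src e = a ∧ tgt e = b) ∨ (src e = b ∧ tgt e = a)) v w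
  bdryVertices : Set V
  mem_bdryVertices_of_degree_one : ∀ v,
    {e | src e = v}.ncard + {e | tgt e = v}.ncard = 1 → v ∈ bdryVertices

namespace MetricGraph

variable {V E : Type*}

/-- The points of the graph: the vertices, and the points in the open edges. -/
inductive Point (G : MetricGraph V E) where
  | vertex (v : V) : Point G
  | inner (e : E) (t : ℝ) (ht : t ∈ Ioo 0 (G.len e)) : Point G

open Classical in
/-- The parametrization of the closed edge `e` by `[0, len e]`, extended to all of `ℝ` by
constants. -/
noncomputable def edgePt (G : MetricGraph V E) (e : E) (t : ℝ) : G.Point :=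
  if h₀ : t ≤ 0 then .vertex (G.src e)
  else if h₁ : G.len e ≤ t then .vertex (G.tgt e)
  else .inner e t ⟨not_le.1 h₀, not_le.1 h₁⟩

/-- `G.HasPath x y L`: some path of length `L` joins `x` to `y`. A path is a finite concatenation
of segments, each of which runs inside one closed edge. -/
inductive HasPath (G : MetricGraph V E) : G.Point → G.Point → ℝ → Prop
  | refl (x : G.Point) : HasPath G x x 0
  | step (e : E) (s t : ℝ) (hs : s ∈ Icc 0 (G.len e)) (ht : t ∈ Icc 0 (G.len e))
      {y : G.Point} {L : ℝ} (h : HasPath G (G.edgePt e t) y L) :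
      HasPath G (G.edgePt e s) y (|s - t| + L)

variable {G : MetricGraph V E}

theorem HasPath.nonneg {x y : G.Point} {L : ℝ} (h : G.HasPath x y L) : 0 ≤ L := by
  induction h with
  | refl x => exact le_rfl
  | step e s t hs ht h ih => positivity

theorem HasPath.trans {x y z : G.Point} {L M : ℝ} (h : G.HasPath x y L) (h' : G.HasPath y z M) :
    G.HasPath x z (L + M) := by
  induction h with
  | refl x => simpa using h'
  | step e s t hs ht h ih =>
    rw [add_assoc]
    exact .step e s t hs ht (ih h')

theorem HasPath.segment (e : E) {s t : ℝ} (hs : s ∈ Icc 0 (G.len e)) (ht : t ∈ Icc 0 (G.len e)) :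
    G.HasPath (G.edgePt e s) (G.edgePt e t) |s - t| := by
  simpa using HasPath.step e s t hs ht (.refl _)

theorem HasPath.symm {x y : G.Point} {L : ℝ} (h : G.HasPath x y L) : G.HasPath y x L := by
  induction h with
  | refl x => exact .refl x
  | step e s t hs ht h ih =>
    rw [add_comm, abs_sub_comm]
    exact ih.trans (.segment e ht hs)

theorem edgePt_zero (e : E) : G.edgePt e 0 = .vertex (G.src e) := by
  simp [edgePt]

theorem edgePt_len (e : E) : G.edgePt e (G.len e) = .vertex (G.tgt e) := by
  simp [edgePt, not_le.2 (G.len_pos e)]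

theorem edgePt_of_mem_Ioo (e : E) {t : ℝ} (ht : t ∈ Ioo 0 (G.len e)) :
    G.edgePt e t = .inner e t ht := by
  simp [edgePt, not_le.2 ht.1, not_le.2 ht.2]

theorem exists_hasPath (x y : G.Point) : ∃ L, G.HasPath x y L := by
  have hedge : ∀ e, ∃ L, G.HasPath (.vertex (G.src e)) (.vertex (G.tgt e)) L := fun e =>
    ⟨_, by
      have h := HasPath.segment (G := G) e (left_mem_Icc.2 (G.len_pos e).le)
        (right_mem_Icc.2 (G.len_pos e).le)
      rwa [edgePt_zero, edgePt_len] at h⟩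
  have hvert : ∀ v w, ∃ L, G.HasPath (.vertex v) (.vertex w) L := fun v w => by
    induction G.connected v w with
    | refl => exact ⟨0, .refl _⟩
    | tail _ h ih =>
      obtain ⟨L, hL⟩ := ih
      obtain ⟨e, ⟨rfl, rfl⟩ | ⟨rfl, rfl⟩⟩ := h <;> obtain ⟨M, hM⟩ := hedge e
      · exact ⟨_, hL.trans hM⟩
      · exact ⟨_, hL.trans hM.symm⟩
  have hpt : ∀ x : G.Point, ∃ v L, G.HasPath x (.vertex v) L := by
    rintro (v | ⟨e, t, ht⟩)
    · exact ⟨v, 0, .refl _⟩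
    · have h := HasPath.segment (G := G) e (Ioo_subset_Icc_self ht)
        (left_mem_Icc.2 (G.len_pos e).le)
      rw [edgePt_zero, edgePt_of_mem_Ioo e ht] at h
      exact ⟨_, _, h⟩
  obtain ⟨v, L, hL⟩ := hpt x
  obtain ⟨w, M, hM⟩ := hpt y
  obtain ⟨K, hK⟩ := hvert v w
  exact ⟨_, (hL.trans hK).trans hM.symm⟩

theorem bddBelow_lengths (x y : G.Point) : BddBelow {L | G.HasPath x y L} :=
  ⟨0, fun _ h => h.nonneg⟩

/-- The geodesic distance: the infimum of the lengths of the paths joining two points. -/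
noncomputable instance : PseudoMetricSpace G.Point where
  dist x y := sInf {L | G.HasPath x y L}
  dist_self x := le_antisymm (csInf_le (bddBelow_lengths x x) (.refl x))
    (le_csInf (exists_hasPath x x) fun _ h => h.nonneg)
  dist_comm x y := congrArg sInf (Set.ext fun _ => ⟨HasPath.symm, HasPath.symm⟩)
  dist_triangle x y z := by
    refine le_of_forall_pos_le_add fun ε hε => ?_
    obtain ⟨L, hL, hL'⟩ := exists_lt_of_csInf_lt (exists_hasPath x y)
      (lt_add_of_pos_right (sInf {L | G.HasPath x y L}) (half_pos hε))
    obtain ⟨M, hM, hM'⟩ := exists_lt_of_csInf_lt (exists_hasPath y z)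
      (lt_add_of_pos_right (sInf {L | G.HasPath y z L}) (half_pos hε))
    have := csInf_le (bddBelow_lengths x z) (HasPath.trans hL hM)
    linarith

/-- The metric completion of the graph. -/
abbrev Compl (G : MetricGraph V E) : Type _ := UniformSpace.Completion G.Point

/-- The interior of the graph: all points except the boundary vertices. -/
def interior (G : MetricGraph V E) : Set G.Point := (Point.vertex '' G.bdryVertices)ᶜ

/-- The boundary of the completion: the complement of the interior of the graph. -/
def bdry (G : MetricGraph V E) : Set G.Compl := ((↑) '' G.interior)ᶜ

/-- The component of `f` on the edge `e`, as a function on `[0, len e]` (extended by constants). -/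
noncomputable def edgeFun (f : G.Compl → ℝ) (e : E) (t : ℝ) : ℝ := f (G.edgePt e t)

/-- The sum over the edge ends at `v` of the derivatives of `f` at `v`, computed in coordinates
pointing away from `v`. A loop at `v` contributes both of its ends. -/
noncomputable def outwardDerivSum (f : G.Compl → ℝ) (v : V) : ℝ :=
  ∑ e ∈ (G.finite_src v).toFinset, derivWithin (edgeFun f e) (Icc 0 (G.len e)) 0 +
  ∑ e ∈ (G.finite_tgt v).toFinset, -derivWithin (edgeFun f e) (Icc 0 (G.len e)) (G.len e)

/-- Harmonic functions on the completion: continuous, with vanishing second derivative on each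
edge, and satisfying the Kirchhoff condition at each interior vertex. -/
structure IsHarmonic (f : G.Compl → ℝ) : Prop where
  continuous : Continuous f
  differentiableOn : ∀ e, DifferentiableOn ℝ (edgeFun f e) (Ioo 0 (G.len e))
  hasDerivAt_deriv : ∀ e, ∀ t ∈ Ioo 0 (G.len e), HasDerivAt (deriv (edgeFun f e)) 0 t
  kirchhoff : ∀ v ∉ G.bdryVertices, outwardDerivSum f v = 0

/-- The energy space: the continuous functions on the completion which are absolutely continuous
on each edge and whose derivative is in `L²` of the graph, the Hilbert sum over the edges of the
spaces `L²[0, len e]`. -/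
structure MemEnergySpace (f : G.Compl → ℝ) : Prop where
  continuous : Continuous f
  absolutelyContinuous : ∀ e, AbsolutelyContinuousOnInterval (edgeFun f e) 0 (G.len e)
  memLp : ∀ e, MemLp (deriv (edgeFun f e)) 2 (volume.restrict (Icc 0 (G.len e)))
  summable : Summable fun e => ∫ t in Icc 0 (G.len e), deriv (edgeFun f e) t ^ 2

/-- The set of finite energy harmonic functions. -/
def finiteEnergyHarmonic (G : MetricGraph V E) : Set (G.Compl → ℝ) :=
  {f | IsHarmonic f ∧ MemEnergySpace f}

end MetricGraph

namespace MetricGraph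

variable {V E : Type*} {G : MetricGraph V E}

/-! The solution minimizes energy among the edgewise affine functions with the given boundary values
(Dirichlet principle). An edgewise affine function with slopes `b e` is recorded by the vector `y e
= b e * √(len e)`, so that finite energy means `y` lies in `ℓ²(E)` and the energy is `‖y‖²`.

Existence needs a competitor. A Urysohn function for a clopen part of the boundary takes
intermediate values only on a compact set of interior points. Such a set meets finitely many edges
(`finite_edges_of_isCompact`), so after truncation the function is constant on all other edges and
can be interpolated affinely on the rest (`exists_extension_indicator`). The vector of a competitor
is then projected orthogonally to `zeroBdryGradients`. This subspace is closed, because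
Cauchy–Schwarz along a path without repeated edges bounds oscillation by energy (`abs_sub_le_norm`).
Orthogonality to the tent function at an interior vertex is the Kirchhoff condition there
(`inner_tent`).

Uniqueness is the maximum principle (`nonpos_of_bdry`): an interior positive maximum spreads along
edges by connectedness, and by density reaches the boundary. -/

theorem exists_pos_le_of_finite {ι : Type*} {S : Set ι} (hS : S.Finite) {f : ι → ℝ}
    (hf : ∀ i ∈ S, 0 < f i) : ∃ r > 0, ∀ i ∈ S, r ≤ f i := by
  rcases S.eq_empty_or_nonempty with rfl | hne
  · exact ⟨1, one_pos, by simp⟩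
  · obtain ⟨i, hi, h⟩ := Set.exists_min_image S f hS hne
    exact ⟨f i, hf i hi, h⟩

/-! ### The geodesic distance -/

theorem HasPath.dist_le {x y : G.Point} {L : ℝ} (h : G.HasPath x y L) : dist x y ≤ L :=
  csInf_le (bddBelow_lengths x y) h

theorem exists_hasPath_of_dist_lt {x y : G.Point} {r : ℝ} (h : dist x y < r) :
    ∃ L < r, G.HasPath x y L := by
  obtain ⟨L, hL, hr⟩ := exists_lt_of_csInf_lt (exists_hasPath x y) h
  exact ⟨L, hr, hL⟩

theorem edgePt_clamp (e : E) (t : ℝ) : G.edgePt e (max 0 (min (G.len e) t)) = G.edgePt e t := by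
  have hl := G.len_pos e
  rcases le_total t 0 with h | h
  · rw [min_eq_right (h.trans hl.le), max_eq_left h]
    simp [edgePt, h]
  rcases le_total (G.len e) t with h' | h'
  · rw [min_eq_left h', max_eq_right hl.le]
    simp [edgePt, h', not_le.2 hl, not_le.2 (hl.trans_le h')]
  · rw [min_eq_right h', max_eq_right h]

theorem lipschitzWith_edgePt (e : E) : LipschitzWith 1 (G.edgePt e) := by
  refine LipschitzWith.of_dist_le_mul fun s t => ?_
  have hmem : ∀ t, max 0 (min (G.len e) t) ∈ Icc 0 (G.len e) := fun t =>
    ⟨le_max_left _ _, max_le (G.len_pos e).le (min_le_left _ _)⟩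
  rw [← edgePt_clamp e s, ← edgePt_clamp e t, NNReal.coe_one, one_mul, Real.dist_eq]
  refine (HasPath.segment e (hmem s) (hmem t)).dist_le.trans ?_
  refine (abs_max_sub_max_le_max _ _ _ _).trans (max_le (by simp) ?_)
  exact (abs_min_sub_min_le_max _ _ _ _).trans (max_le (by simp) le_rfl)

theorem continuous_edgePt (e : E) : Continuous (G.edgePt e) :=
  (lipschitzWith_edgePt e).continuous

theorem continuous_coe_edgePt (e : E) : Continuous fun t => (G.edgePt e t : G.Compl) :=
  (UniformSpace.Completion.continuous_coe _).comp (continuous_edgePt e)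

/-- A function that is `M`-Lipschitz along every edge is `M`-Lipschitz. -/
theorem lipschitzWith_of_edges {f : G.Point → ℝ} {M : NNReal}
    (hf : ∀ e, ∀ s ∈ Icc 0 (G.len e), ∀ t ∈ Icc 0 (G.len e),
      |f (G.edgePt e s) - f (G.edgePt e t)| ≤ M * |s - t|) : LipschitzWith M f := by
  have key : ∀ {x y L}, G.HasPath x y L → |f x - f y| ≤ M * L := by
    intro x y L h
    induction h with
    | refl x => simp
    | step e s t hs ht h ih =>
      rw [mul_add]
      exact (abs_sub_le _ (f (G.edgePt e t)) _).trans (add_le_add (hf e s hs t ht) ih)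
  refine LipschitzWith.of_dist_le_mul fun x y => le_of_forall_pos_le_add fun ε hε => ?_
  -- The infimum need not be attained; the denominator `M + 1` allows `M = 0`.
  obtain ⟨L, hL, h⟩ := exists_hasPath_of_dist_lt
    (lt_add_of_pos_right (dist x y) (show 0 < ε / (M + 1) by positivity))
  have h1 := key h
  have h2 : (M : ℝ) * L ≤ M * (dist x y + ε / (M + 1)) := by gcongr
  have h3 : (M : ℝ) * (ε / (M + 1)) ≤ ε := by
    rw [mul_div_assoc', div_le_iff₀ (by positivity)]
    nlinarith
  rw [Real.dist_eq]
  linarith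

/-! ### Edge paths -/

/-- The edge `e` joins `v` and `w`, in some orientation. -/
def Joins (G : MetricGraph V E) (e : E) (v w : V) : Prop :=
  (G.src e = v ∧ G.tgt e = w) ∨ (G.src e = w ∧ G.tgt e = v)

/-- `G.EdgePath v w l`: the edges in the list `l` form a path from `v` to `w`. -/
inductive EdgePath (G : MetricGraph V E) : V → V → List E → Prop
  | nil (v : V) : EdgePath G v v []
  | cons {v a w : V} {l : List E} (e : E) (he : G.Joins e v a) (h : EdgePath G a w l) :
      EdgePath G v w (e :: l)

/-- The length of a list of edges. -/
def pathLen (G : MetricGraph V E) (l : List E) : ℝ := (l.map G.len).sum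

@[simp] theorem pathLen_nil : G.pathLen [] = 0 := rfl

@[simp] theorem pathLen_cons (e : E) (l : List E) : G.pathLen (e :: l) = G.len e + G.pathLen l := by
  simp [pathLen]

theorem pathLen_nonneg (l : List E) : 0 ≤ G.pathLen l := by
  induction l with
  | nil => simp
  | cons e l ih =>
    rw [pathLen_cons]
    exact add_nonneg (G.len_pos e).le ih

theorem pathLen_le_of_suffix {l l' : List E} (h : l <:+ l') : G.pathLen l ≤ G.pathLen l' := by
  obtain ⟨p, rfl⟩ := h
  have := G.pathLen_nonneg p
  simp only [pathLen, List.map_append, List.sum_append] at *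
  linarith

/-- This cuts a path at an occurrence of `e`. The suffix form preserves the absence of repetitions
and does not increase length. -/
theorem EdgePath.exists_suffix {v w : V} {l : List E} (h : G.EdgePath v w l) {e : E} (he : e ∈ l) :
    ∃ a b q, G.Joins e a b ∧ G.EdgePath b w q ∧ (e :: q) <:+ l := by
  induction h with
  | nil v => simp at he
  | @cons v a w l e' he' h ih =>
    rcases List.mem_cons.1 he with rfl | he
    · exact ⟨v, a, l, he', h, List.suffix_rfl⟩
    · obtain ⟨a', b, q, h₁, h₂, h₃⟩ := ih he
      exact ⟨a', b, q, h₁, h₂, h₃.trans (List.suffix_cons _ _)⟩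

/-- An edge path can be shortened so that it uses every edge at most once. -/
theorem EdgePath.exists_nodup {v w : V} {l : List E} (h : G.EdgePath v w l) :
    ∃ l', G.EdgePath v w l' ∧ l'.Nodup ∧ G.pathLen l' ≤ G.pathLen l := by
  induction h with
  | nil v => exact ⟨[], .nil v, List.nodup_nil, le_rfl⟩
  | @cons v a w l e he h ih =>
    obtain ⟨l', hp, hn, hl⟩ := ih
    have hle := (G.len_pos e).le
    by_cases hmem : e ∈ l'
    · obtain ⟨x, y, q, hj, hq, hs⟩ := hp.exists_suffix hmem
      have hs' : q <:+ l' := (List.suffix_cons e q).trans hs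
      have h₁ := G.pathLen_le_of_suffix hs
      have h₂ := G.pathLen_le_of_suffix hs'
      -- Both crossings of `e` have the same two ends. If the later one ends at `v`, everything
      -- before its end is dropped; if it ends at `a`, a single crossing of `e` is kept.
      have hcase : y = v ∨ y = a := by
        rcases he with ⟨rfl, rfl⟩ | ⟨rfl, rfl⟩ <;> rcases hj with ⟨rfl, rfl⟩ | ⟨rfl, rfl⟩ <;> simp
      rcases hcase with rfl | rfl
      · exact ⟨q, hq, hn.sublist hs'.sublist, by rw [pathLen_cons]; linarith⟩
      · exact ⟨e :: q, .cons e he hq, hn.sublist hs.sublist, by rw [pathLen_cons e l]; linarith⟩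
    · exact ⟨e :: l', .cons e he hp, List.nodup_cons.2 ⟨hmem, hn⟩, by simpa using hl⟩

/-- The edge path from `v` to `w` ends with an edge at `w`. -/
theorem EdgePath.eq_or_exists_edge {v w : V} {l : List E} (h : G.EdgePath v w l) :
    v = w ∨ ∃ e, (G.src e = w ∨ G.tgt e = w) ∧ G.len e ≤ G.pathLen l := by
  induction h with
  | nil v => exact .inl rfl
  | @cons v a w l e he h ih =>
    right
    rw [pathLen_cons]
    rcases ih with rfl | ⟨e', h₁, h₂⟩
    · refine ⟨e, ?_, by linarith [G.pathLen_nonneg l]⟩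
      rcases he with he | he
      · exact .inr he.2
      · exact .inl he.1
    · exact ⟨e', h₁, by linarith [G.len_pos e]⟩

/-- `G.Reaches w x L`: the vertex `w` can be reached from the point `x` by first going to an end of
the edge that contains `x` and then along an edge path, with total length at most `L`. -/
def Reaches (G : MetricGraph V E) (w : V) : G.Point → ℝ → Prop
  | .vertex v, L => ∃ l, G.EdgePath v w l ∧ G.pathLen l ≤ L
  | .inner e t _, L => (∃ l, G.EdgePath (G.src e) w l ∧ t + G.pathLen l ≤ L) ∨
      ∃ l, G.EdgePath (G.tgt e) w l ∧ G.len e - t + G.pathLen l ≤ L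

/-- At an endpoint of `e`, the route through the opposite end crosses all of `e`, so it is absorbed
by prepending `e` to the edge path. Vertices and inner points can then be treated alike. -/
theorem reaches_edgePt_iff {w : V} {e : E} {t L : ℝ} (ht : t ∈ Icc 0 (G.len e)) :
    G.Reaches w (G.edgePt e t) L ↔ (∃ l, G.EdgePath (G.src e) w l ∧ t + G.pathLen l ≤ L) ∨
      ∃ l, G.EdgePath (G.tgt e) w l ∧ G.len e - t + G.pathLen l ≤ L := by
  rcases eq_endpoints_or_mem_Ioo_of_mem_Icc ht with rfl | rfl | h
  · rw [edgePt_zero]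
    refine ⟨fun ⟨l, h, hl⟩ => .inl ⟨l, h, by linarith⟩, ?_⟩
    rintro (⟨l, h, hl⟩ | ⟨l, h, hl⟩)
    · exact ⟨l, h, by linarith⟩
    · exact ⟨e :: l, .cons e (.inl ⟨rfl, rfl⟩) h, by rw [pathLen_cons]; linarith⟩
  · rw [edgePt_len]
    refine ⟨fun ⟨l, h, hl⟩ => .inr ⟨l, h, by linarith⟩, ?_⟩
    rintro (⟨l, h, hl⟩ | ⟨l, h, hl⟩)
    · exact ⟨e :: l, .cons e (.inr ⟨rfl, rfl⟩) h, by rw [pathLen_cons]; linarith⟩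
    · exact ⟨l, h, by linarith⟩
  · rw [edgePt_of_mem_Ioo e h]
    rfl

/-- A move from `s` to `t` inside an edge changes the distance to each end by at most `|s - t|`.
Hence a path that may turn back inside edges can be replaced by an edge path that is no longer. -/
theorem HasPath.reaches {x : G.Point} {w : V} {L : ℝ} (h : G.HasPath x (.vertex w) L) :
    G.Reaches w x L := by
  generalize hy : Point.vertex w = y at h
  induction h with
  | refl x =>
    subst hy
    exact ⟨[], .nil w, le_rfl⟩
  | step e s t hs ht h ih =>
    rw [reaches_edgePt_iff hs]
    rcases (reaches_edgePt_iff ht).1 (ih hy) with ⟨l, h, hl⟩ | ⟨l, h, hl⟩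
    · exact .inl ⟨l, h, by linarith [le_abs_self (s - t)]⟩
    · exact .inr ⟨l, h, by linarith [neg_abs_le (s - t)]⟩

/-! ### Neighbourhoods of points -/

/-- Every interior point has a ball that consists of interior points, is covered by the point and
finitely many edges, and does not meet the other edges. -/
theorem exists_ball_subset {x : G.Point} (hx : x ∈ G.interior) :
    ∃ r > 0, ∃ S : Set E, S.Finite ∧ Metric.ball x r ⊆ G.interior ∧
      (∀ y ∈ Metric.ball x r, y = x ∨ ∃ e ∈ S, ∃ t ∈ Icc 0 (G.len e), G.edgePt e t = y) ∧
      ∀ e, ∀ t ∈ Icc 0 (G.len e), G.edgePt e t ∈ Metric.ball x r → e ∈ S := by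
  cases x with
  | vertex v =>
    have hv : v ∉ G.bdryVertices := fun h => hx ⟨v, h, rfl⟩
    set S : Set E := {e | G.src e = v} ∪ {e | G.tgt e = v} with hS
    have hSf : S.Finite := (G.finite_src v).union (G.finite_tgt v)
    -- With this radius, a path of length less than `r` ending at `v` cannot contain a whole edge
    -- ending at `v`.
    obtain ⟨r, hr, hrS⟩ : ∃ r > 0, ∀ e ∈ S, r ≤ G.len e :=
      exists_pos_le_of_finite hSf fun e _ => G.len_pos e
    have key : ∀ y ∈ Metric.ball (Point.vertex v : G.Point) r, y = .vertex v ∨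
        ∃ e ∈ S, ∃ t, ∃ ht : t ∈ Ioo 0 (G.len e), y = .inner e t ht := by
      intro y hy
      obtain ⟨L, hL, h⟩ := exists_hasPath_of_dist_lt hy
      have hshort : ∀ {a l}, G.EdgePath a v l → G.pathLen l ≤ L → a = v := fun {a l} h hl =>
        h.eq_or_exists_edge.resolve_right fun ⟨e, he, hel⟩ => by
          linarith [hrS e he]
      have h' := h.reaches
      cases y with
      | vertex a =>
        obtain ⟨l, hl, hlL⟩ := h'
        exact .inl (by rw [hshort hl hlL])
      | inner e t ht =>
        refine .inr ⟨e, ?_, t, ht, rfl⟩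
        rcases h' with ⟨l, hl, hlL⟩ | ⟨l, hl, hlL⟩
        · exact .inl (hshort hl (by linarith [ht.1]))
        · exact .inr (hshort hl (by linarith [ht.2]))
    refine ⟨r, hr, S, hSf, ?_, ?_, ?_⟩
    · intro y hy
      rcases key y hy with rfl | ⟨e, -, t, ht, rfl⟩
      · exact hx
      · rintro ⟨w, -, hw⟩
        cases hw
    · intro y hy
      rcases key y hy with rfl | ⟨e, he, t, ht, rfl⟩
      · exact .inl rfl
      · exact .inr ⟨e, he, t, Ioo_subset_Icc_self ht, edgePt_of_mem_Ioo e ht⟩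
    · intro e t ht hy
      have hk := key _ hy
      rcases eq_endpoints_or_mem_Ioo_of_mem_Icc ht with rfl | rfl | h
      · rw [edgePt_zero] at hk
        exact .inl (by simpa using hk)
      · rw [edgePt_len] at hk
        exact .inr (by simpa using hk)
      · rw [edgePt_of_mem_Ioo e h] at hk
        rcases hk with hk | ⟨e', he', t', ht', hk⟩
        · cases hk
        · cases hk
          exact he'
  | inner e t ht =>
    -- A path ending at the inner point and shorter than its distance to both ends of `e` never
    -- leaves the open edge.
    have key : ∀ {x y L}, G.HasPath x y L → y = .inner e t ht → L < min t (G.len e - t) →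
        ∃ s, ∃ hs : s ∈ Ioo 0 (G.len e), x = .inner e s hs ∧ |s - t| ≤ L := by
      intro x y L h hy hL
      induction h with
      | refl x => exact ⟨t, ht, hy, by simp⟩
      | @step e' s t' hs ht' y L h ih =>
        obtain ⟨s', hs', h₁, h₂⟩ := ih hy (by linarith [abs_nonneg (s - t')])
        have hee : e' = e ∧ t' = s' := by
          rcases eq_endpoints_or_mem_Ioo_of_mem_Icc ht' with rfl | rfl | h
          · rw [edgePt_zero] at h₁
            cases h₁
          · rw [edgePt_len] at h₁
            cases h₁
          · rw [edgePt_of_mem_Ioo e' h] at h₁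
            cases h₁
            exact ⟨rfl, rfl⟩
        obtain ⟨rfl, rfl⟩ := hee
        have h₃ : |s - t| ≤ |s - t'| + L := (abs_sub_le _ t' _).trans (by linarith)
        have h₄ := abs_lt.1 (h₃.trans_lt hL)
        have h₅ := min_le_left t (G.len e' - t)
        have h₆ := min_le_right t (G.len e' - t)
        have hs'' : s ∈ Ioo 0 (G.len e') := ⟨by linarith, by linarith⟩
        exact ⟨s, hs'', edgePt_of_mem_Ioo _ hs'', h₃⟩
    have key' : ∀ y ∈ Metric.ball (Point.inner e t ht) (min t (G.len e - t)),
        ∃ s, ∃ hs : s ∈ Ioo 0 (G.len e), y = .inner e s hs := fun y hy => by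
      obtain ⟨L, hL, h⟩ := exists_hasPath_of_dist_lt hy
      obtain ⟨s, hs, h₁, -⟩ := key h rfl hL
      exact ⟨s, hs, h₁⟩
    refine ⟨min t (G.len e - t), lt_min ht.1 (sub_pos.2 ht.2), {e}, finite_singleton e, ?_, ?_, ?_⟩
    · intro y hy
      obtain ⟨s, hs, rfl⟩ := key' y hy
      rintro ⟨w, -, hw⟩
      cases hw
    · intro y hy
      obtain ⟨s, hs, rfl⟩ := key' y hy
      exact .inr ⟨e, rfl, s, Ioo_subset_Icc_self hs, edgePt_of_mem_Ioo e hs⟩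
    · intro e' t' ht' hy
      obtain ⟨s, hs, h₁⟩ := key' _ hy
      rcases eq_endpoints_or_mem_Ioo_of_mem_Icc ht' with rfl | rfl | h
      · rw [edgePt_zero] at h₁
        cases h₁
      · rw [edgePt_len] at h₁
        cases h₁
      · rw [edgePt_of_mem_Ioo e' h] at h₁
        cases h₁
        rfl

theorem isCompact_edge (e : E) : IsCompact (G.edgePt e '' Icc 0 (G.len e)) :=
  isCompact_Icc.image (continuous_edgePt e)

/-- A small closed ball around an interior point is compact, being closed in a finite union of edges
and a point, so its image is closed in the completion. By density the closure of that image is a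
neighbourhood; hence completing adds no points nearby. -/
theorem isOpen_coe_interior : IsOpen ((↑) '' G.interior : Set G.Compl) := by
  rw [isOpen_iff_mem_nhds]
  rintro _ ⟨x, hx, rfl⟩
  obtain ⟨r, hr, S, hS, hint, hcov, -⟩ := exists_ball_subset hx
  have hsub : Metric.closedBall x (r / 2) ⊆ Metric.ball x r :=
    Metric.closedBall_subset_ball (half_lt_self hr)
  have hK : IsCompact (Metric.closedBall x (r / 2)) := by
    have : IsCompact ({x} ∪ ⋃ e ∈ S, G.edgePt e '' Icc 0 (G.len e)) :=
      isCompact_singleton.union (hS.isCompact_biUnion fun e _ => isCompact_edge e)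
    refine this.of_isClosed_subset Metric.isClosed_closedBall fun y hy => ?_
    rcases hcov y (hsub hy) with rfl | ⟨e, he, t, ht, rfl⟩
    · exact .inl rfl
    · exact .inr (mem_biUnion he ⟨t, ht, rfl⟩)
  have hK' := (hK.image (UniformSpace.Completion.continuous_coe G.Point)).isClosed
  have hn := (UniformSpace.Completion.isDenseInducing_coe (α := G.Point)).closure_image_mem_nhds
    (Metric.closedBall_mem_nhds x (half_pos hr))
  rw [hK'.closure_eq] at hn
  exact Filter.mem_of_superset hn (image_mono (hsub.trans hint))

theorem isClosed_bdry : IsClosed G.bdry := isOpen_coe_interior.isClosed_compl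

/-- The completion identifies points at distance zero; balls of interior points avoid boundary
vertices, which rules out such an identification here. -/
theorem mem_bdry_of_mem_bdryVertices {v : V} (hv : v ∈ G.bdryVertices) :
    ((Point.vertex v : G.Point) : G.Compl) ∈ G.bdry := by
  rintro ⟨x, hx, hxv⟩
  obtain ⟨r, hr, S, -, hint, -⟩ := exists_ball_subset hx
  refine hint (show Point.vertex v ∈ Metric.ball x r from ?_) ⟨v, hv, rfl⟩
  rw [Metric.mem_ball, ← UniformSpace.Completion.dist_eq, hxv, dist_self]
  exact hr

/-- A continuous function on the completion that vanishes at the boundary vertices and at all points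
of the graph outside a compact set vanishes on the boundary. -/
theorem eq_zero_on_bdry {h : G.Compl → ℝ} (hc : Continuous h) {K : Set G.Point} (hK : IsCompact K)
    (hout : ∀ x ∉ K, h x = 0) (hb : ∀ v ∈ G.bdryVertices, h (Point.vertex v : G.Point) = 0)
    {z : G.Compl} (hz : z ∈ G.bdry) : h z = 0 := by
  -- This closed set contains the dense image of the graph, so it is the whole completion.
  have hcl : IsClosed ((↑) '' K ∪ {z | h z = 0} : Set G.Compl) :=
    (hK.image (UniformSpace.Completion.continuous_coe _)).isClosed.union
      (isClosed_eq hc continuous_const)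
  have hall : z ∈ ((↑) '' K ∪ {z | h z = 0} : Set G.Compl) := by
    refine UniformSpace.Completion.induction_on z hcl fun x => ?_
    by_cases hx : x ∈ K
    · exact .inl ⟨x, hx, rfl⟩
    · exact .inr (hout x hx)
  rcases hall with ⟨x, -, rfl⟩ | h0
  · have hx : x ∈ Point.vertex '' G.bdryVertices := by
      by_contra hx
      exact hz ⟨x, hx, rfl⟩
    obtain ⟨v, hv, rfl⟩ := hx
    exact hb v hv
  · exact h0

/-- A compact set of interior points meets only finitely many edges. -/
theorem finite_edges_of_isCompact {K : Set G.Compl} (hK : IsCompact K) (hKb : Disjoint K G.bdry) :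
    {e | ∃ t ∈ Icc 0 (G.len e), (G.edgePt e t : G.Compl) ∈ K}.Finite := by
  have hloc : ∀ z ∈ K, ∃ U ∈ nhdsWithin z K,
      {e | ∃ t ∈ Icc 0 (G.len e), (G.edgePt e t : G.Compl) ∈ U}.Finite := by
    intro z hz
    obtain ⟨x, hx, rfl⟩ : z ∈ ((↑) '' G.interior : Set G.Compl) := by
      by_contra h
      exact disjoint_left.1 hKb hz h
    obtain ⟨r, hr, S, hS, -, -, hmeet⟩ := exists_ball_subset hx
    refine ⟨Metric.ball x r, mem_nhdsWithin_of_mem_nhds (Metric.ball_mem_nhds _ hr),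
      hS.subset ?_⟩
    rintro e ⟨t, ht, hU⟩
    refine hmeet e t ht ?_
    rwa [Metric.mem_ball, UniformSpace.Completion.dist_eq] at hU
  refine hK.induction_on (p := fun K => {e | ∃ t ∈ Icc 0 (G.len e),
    (G.edgePt e t : G.Compl) ∈ K}.Finite) (by simp) ?_ ?_ hloc
  · exact fun s t hst ht => ht.subset fun e ⟨a, ha, h⟩ => ⟨a, ha, hst h⟩
  · refine fun s t hs ht => (hs.union ht).subset ?_
    rintro e ⟨a, ha, h | h⟩
    · exact .inl ⟨a, ha, h⟩
    · exact .inr ⟨a, ha, h⟩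

/-! ### Edgewise affine functions -/

/-- The function `f` is affine on every edge `e`, with slope `b e`. -/
def HasSlope (f : G.Compl → ℝ) (b : E → ℝ) : Prop :=
  ∀ e, ∀ t ∈ Icc 0 (G.len e),
    f (G.edgePt e t) = f (Point.vertex (G.src e) : G.Point) + b e * t

namespace HasSlope

variable {f g : G.Compl → ℝ} {b b' : E → ℝ}

theorem congr (h : HasSlope f b) (hb : b = b') : HasSlope f b' := hb ▸ h

theorem add (hf : HasSlope f b) (hg : HasSlope g b') : HasSlope (f + g) (b + b') := by
  intro e t ht
  simp only [Pi.add_apply, hf e t ht, hg e t ht]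
  ring

theorem smul (c : ℝ) (hf : HasSlope f b) : HasSlope (c • f) (c • b) := by
  intro e t ht
  simp only [Pi.smul_apply, hf e t ht, smul_eq_mul]
  ring

theorem sub (hf : HasSlope f b) (hg : HasSlope g b') : HasSlope (f - g) (b - b') := by
  intro e t ht
  simp only [Pi.sub_apply, hf e t ht, hg e t ht]
  ring

theorem apply_tgt (hf : HasSlope f b) (e : E) :
    f (Point.vertex (G.tgt e) : G.Point) =
      f (Point.vertex (G.src e) : G.Point) + b e * G.len e := by
  rw [← hf e _ (right_mem_Icc.2 (G.len_pos e).le), edgePt_len]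

theorem hasDerivWithinAt (hf : HasSlope f b) (e : E) {t : ℝ} (ht : t ∈ Icc 0 (G.len e)) :
    HasDerivWithinAt (edgeFun f e) (b e) (Icc 0 (G.len e)) t := by
  have h : HasDerivWithinAt (fun t => f (Point.vertex (G.src e) : G.Point) + b e * t) (b e)
      (Icc 0 (G.len e)) t := by
    simpa using ((hasDerivWithinAt_id t (Icc 0 (G.len e))).const_mul (b e)).const_add
      (f (Point.vertex (G.src e) : G.Point))
  exact h.congr (fun s hs => hf e s hs) (hf e t ht)

theorem derivWithin (hf : HasSlope f b) (e : E) {t : ℝ} (ht : t ∈ Icc 0 (G.len e)) :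
    derivWithin (edgeFun f e) (Icc 0 (G.len e)) t = b e :=
  (hf.hasDerivWithinAt e ht).derivWithin (uniqueDiffOn_Icc (G.len_pos e) t ht)

theorem hasDerivAt (hf : HasSlope f b) (e : E) {t : ℝ} (ht : t ∈ Ioo 0 (G.len e)) :
    HasDerivAt (edgeFun f e) (b e) t :=
  (hf.hasDerivWithinAt e (Ioo_subset_Icc_self ht)).hasDerivAt (Icc_mem_nhds ht.1 ht.2)

theorem outwardDerivSum_eq (hf : HasSlope f b) (v : V) :
    outwardDerivSum f v =
      ∑ e ∈ (G.finite_src v).toFinset, b e - ∑ e ∈ (G.finite_tgt v).toFinset, b e := by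
  rw [outwardDerivSum, sub_eq_add_neg, ← Finset.sum_neg_distrib]
  congr 1
  · exact Finset.sum_congr rfl fun e _ => hf.derivWithin e (left_mem_Icc.2 (G.len_pos e).le)
  · exact Finset.sum_congr rfl fun e _ => by
      rw [hf.derivWithin e (right_mem_Icc.2 (G.len_pos e).le)]

theorem isHarmonic (hf : HasSlope f b) (hc : Continuous f)
    (hk : ∀ v ∉ G.bdryVertices, outwardDerivSum f v = 0) : IsHarmonic f where
  continuous := hc
  differentiableOn e t ht := (hf.hasDerivAt e ht).differentiableAt.differentiableWithinAt
  hasDerivAt_deriv e t ht := by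
    refine (hasDerivAt_const t (b e)).congr_of_eventuallyEq ?_
    filter_upwards [Ioo_mem_nhds ht.1 ht.2] with s hs
    exact (hf.hasDerivAt e hs).deriv
  kirchhoff := hk

theorem memEnergySpace (hf : HasSlope f b) (hc : Continuous f)
    (hb : Summable fun e => b e ^ 2 * G.len e) : MemEnergySpace f where
  continuous := hc
  absolutelyContinuous e := by
    refine LipschitzOnWith.absolutelyContinuousOnInterval (K := ‖b e‖₊) ?_
    rw [uIcc_of_le (G.len_pos e).le]
    refine LipschitzOnWith.of_dist_le_mul fun s hs t ht => ?_
    rw [edgeFun, edgeFun, hf e s hs, hf e t ht, dist_add_left, Real.dist_eq, Real.dist_eq,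
      ← mul_sub, abs_mul]
    simp
  memLp e := by
    have h : deriv (edgeFun f e) =ᵐ[volume.restrict (Icc 0 (G.len e))] fun _ => b e := by
      rw [← Measure.restrict_congr_set Ioo_ae_eq_Icc]
      filter_upwards [ae_restrict_mem measurableSet_Ioo] with t ht
      exact (hf.hasDerivAt e ht).deriv
    exact (memLp_congr_ae h).2 (memLp_const _)
  summable := by
    refine hb.congr fun e => ?_
    rw [← setIntegral_congr_set Ioo_ae_eq_Icc,
      setIntegral_congr_fun measurableSet_Ioo (g := fun _ => b e ^ 2)
        (fun t ht => by simp only [(hf.hasDerivAt e ht).deriv])]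
    simp [(G.len_pos e).le, mul_comm]

/-- On the points of the graph, an edgewise affine function takes values between those at the
vertices. -/
theorem abs_sub_le_of_vertices (hf : HasSlope f b) {c K : ℝ}
    (h : ∀ v, |f (Point.vertex v : G.Point) - c| ≤ K) (x : G.Point) : |f x - c| ≤ K := by
  cases x with
  | vertex v => exact h v
  | inner e t ht =>
    have h₀ := abs_le.1 (h (G.src e))
    have h₁ := abs_le.1 (h (G.tgt e))
    rw [hf.apply_tgt] at h₁
    rw [← edgePt_of_mem_Ioo, hf e t (Ioo_subset_Icc_self ht)]
    rcases le_total 0 (b e) with hb | hb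
    · have h₂ := mul_nonneg hb ht.1.le
      have h₃ := mul_le_mul_of_nonneg_left ht.2.le hb
      exact abs_le.2 ⟨by linarith, by linarith⟩
    · have h₂ := mul_nonpos_of_nonpos_of_nonneg hb ht.1.le
      have h₃ := mul_le_mul_of_nonpos_left ht.2.le hb
      exact abs_le.2 ⟨by linarith, by linarith⟩

theorem abs_sub_le_of_edgePath (hf : HasSlope f b) {v w : V} {l : List E} (h : G.EdgePath v w l) :
    |f (Point.vertex v : G.Point) - f (Point.vertex w : G.Point)| ≤
      (l.map fun e => |b e| * G.len e).sum := by
  induction h with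
  | nil v => simp
  | @cons v a w l e he h ih =>
    rw [List.map_cons, List.sum_cons]
    refine (abs_sub_le _ (f (Point.vertex a : G.Point)) _).trans (add_le_add ?_ ih)
    have hl := (G.len_pos e).le
    rcases he with ⟨rfl, rfl⟩ | ⟨rfl, rfl⟩ <;>
      rw [hf.apply_tgt] <;> simp [abs_mul, abs_of_nonneg hl]

/-- The oscillation of an edgewise affine function is bounded by its energy. -/
theorem abs_sub_le_norm {y : lp (fun _ : E => ℝ) 2} (hf : HasSlope f fun e => y e / √(G.len e))
    {D : ℝ} (hD : ∀ x y : G.Point, dist x y < D) (v w : V) :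
    |f (Point.vertex v : G.Point) - f (Point.vertex w : G.Point)| ≤ √D * ‖y‖ := by
  classical
  obtain ⟨L, hL, hp⟩ := exists_hasPath_of_dist_lt (hD (.vertex v) (.vertex w))
  obtain ⟨l₀, hl₀, hlen₀⟩ := hp.reaches
  -- Without repetitions, sums along the path are sums over a finite set of edges, which `‖y‖²`
  -- controls.
  obtain ⟨l, hl, hn, hlen⟩ := hl₀.exists_nodup
  refine (hf.abs_sub_le_of_edgePath hl).trans ?_
  rw [← List.sum_toFinset _ hn]
  -- The variation over `e` is split into the two factors for Cauchy–Schwarz: one gives the path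
  -- length, the other the energy.
  have h₁ : ∀ e, |y e / √(G.len e)| * G.len e = √(G.len e) * |y e| := fun e => by
    have hs := Real.sqrt_pos.2 (G.len_pos e)
    rw [abs_div, abs_of_pos hs, div_mul_eq_mul_div, div_eq_iff hs.ne', mul_right_comm,
      Real.mul_self_sqrt (G.len_pos e).le, mul_comm]
  simp only [h₁]
  have h₂ : ∑ e ∈ l.toFinset, √(G.len e) ^ 2 ≤ D := by
    rw [Finset.sum_congr rfl fun e _ => Real.sq_sqrt (G.len_pos e).le, List.sum_toFinset _ hn]
    exact (hlen.trans hlen₀).trans hL.le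
  have h₃ : ∑ e ∈ l.toFinset, |y e| ^ 2 ≤ ‖y‖ ^ 2 := by
    have := lp.sum_rpow_le_norm_rpow (p := 2) (by norm_num) y l.toFinset
    simpa using this
  have hD0 : 0 ≤ D := dist_nonneg.trans (hD (.vertex v) (.vertex v)).le
  refine le_of_abs_le (abs_le_of_sq_le_sq ?_ (by positivity))
  rw [mul_pow, Real.sq_sqrt hD0]
  exact (Finset.sum_mul_sq_le_sq_mul_sq _ _ _).trans
    (mul_le_mul h₂ h₃ (Finset.sum_nonneg fun _ _ => sq_nonneg _) hD0)

theorem abs_sub_le_norm_compl {y : lp (fun _ : E => ℝ) 2}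
    (hf : HasSlope f fun e => y e / √(G.len e)) (hc : Continuous f)
    {D : ℝ} (hD : ∀ x y : G.Point, dist x y < D) (z z' : G.Compl) :
    |f z - f z'| ≤ √D * ‖y‖ := by
  refine UniformSpace.Completion.induction_on₂ z z' (isClosed_le (by fun_prop) (by fun_prop)) ?_
  intro x x'
  refine hf.abs_sub_le_of_vertices (fun v => ?_) x
  rw [abs_sub_comm]
  exact hf.abs_sub_le_of_vertices (fun w => hf.abs_sub_le_norm hD w v) x'

/-- The maximum principle. -/
theorem nonpos_of_bdry [CompactSpace G.Compl] (hf : HasSlope f b) (hc : Continuous f)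
    (hk : ∀ v ∉ G.bdryVertices,
      ∑ e ∈ (G.finite_src v).toFinset, b e - ∑ e ∈ (G.finite_tgt v).toFinset, b e = 0)
    (hne : G.bdry.Nonempty) (h0 : ∀ z ∈ G.bdry, f z = 0) (z : G.Compl) : f z ≤ 0 := by
  obtain ⟨m, -, hm⟩ := isCompact_univ.exists_isMaxOn ⟨z, mem_univ z⟩ hc.continuousOn
  have hle : ∀ z, f z ≤ f m := fun z => hm (mem_univ z)
  refine (hle z).trans (not_lt.1 fun hpos => ?_)
  -- A positive maximum is not on the boundary, and an affine function with a maximum inside an edge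
  -- is constant on that edge.
  have hvert : ∃ v, f (Point.vertex v : G.Point) = f m := by
    obtain ⟨x, -, hx⟩ : m ∈ ((↑) '' G.interior : Set G.Compl) := by
      by_contra h
      exact hpos.ne' (h0 m h)
    cases x with
    | vertex v => exact ⟨v, by rw [hx]⟩
    | inner e t ht =>
      refine ⟨G.src e, le_antisymm (hle _) ?_⟩
      have h₁ := hle (Point.vertex (G.tgt e) : G.Point)
      have h₂ := hf e t (Ioo_subset_Icc_self ht)
      rw [edgePt_of_mem_Ioo e ht, hx] at h₂
      rw [hf.apply_tgt, h₂] at h₁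
      have h₃ : b e * (G.len e - t) ≤ 0 := by linarith
      have h₄ : b e ≤ 0 := nonpos_of_mul_nonpos_left h₃ (sub_pos.2 ht.2)
      linarith [mul_nonpos_of_nonpos_of_nonneg h₄ ht.1.le]
  -- At a maximum all outward slopes are nonpositive; their sum is zero, so each vanishes.
  have hslope : ∀ v, f (Point.vertex v : G.Point) = f m →
      ∀ e, (G.src e = v ∨ G.tgt e = v) → b e = 0 := by
    intro v hv
    have hvi : v ∉ G.bdryVertices := fun h => by
      rw [h0 _ (mem_bdry_of_mem_bdryVertices h)] at hv
      exact hpos.ne hv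
    have hs : ∀ e ∈ (G.finite_src v).toFinset, b e ≤ 0 := fun e he => by
      have he' : G.src e = v := by simpa using he
      have h₁ := hle (Point.vertex (G.tgt e) : G.Point)
      rw [hf.apply_tgt, he', hv] at h₁
      exact nonpos_of_mul_nonpos_left (by linarith) (G.len_pos e)
    have ht : ∀ e ∈ (G.finite_tgt v).toFinset, 0 ≤ b e := fun e he => by
      have he' : G.tgt e = v := by simpa using he
      have h₁ := hle (Point.vertex (G.src e) : G.Point)
      have h₂ := hf.apply_tgt e
      rw [he', hv] at h₂
      exact nonneg_of_mul_nonneg_left (by linarith) (G.len_pos e)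
    have h₁ := Finset.sum_nonpos hs
    have h₂ := Finset.sum_nonneg ht
    have h₃ := hk v hvi
    rintro e (he | he)
    · exact (Finset.sum_eq_zero_iff_of_nonpos hs).1 (by linarith) e (by simpa using he)
    · exact (Finset.sum_eq_zero_iff_of_nonneg ht).1 (by linarith) e (by simpa using he)
  have hall : ∀ w, f (Point.vertex w : G.Point) = f m := by
    obtain ⟨v, hv⟩ := hvert
    intro w
    induction G.connected v w with
    | refl => exact hv
    | @tail a c _ hac ih =>
      obtain ⟨e, ⟨rfl, rfl⟩ | ⟨rfl, rfl⟩⟩ := hac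
      · rw [hf.apply_tgt, hslope _ ih e (.inl rfl), ih, zero_mul, add_zero]
      · rw [← ih, hf.apply_tgt, hslope _ ih e (.inr rfl), zero_mul, add_zero]
  obtain ⟨z₀, hz₀⟩ := hne
  have hconst : f z₀ = f m := by
    refine UniformSpace.Completion.induction_on z₀ (isClosed_eq hc continuous_const) fun x => ?_
    have := hf.abs_sub_le_of_vertices (c := f m) (K := 0) (fun v => by rw [hall v]; simp) x
    exact sub_eq_zero.1 (abs_nonpos_iff.1 this)
  rw [h0 z₀ hz₀] at hconst
  exact hpos.ne hconst

end HasSlope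

/-! ### Harmonic functions are edgewise affine; comparison -/

theorem IsHarmonic.exists_hasSlope {f : G.Compl → ℝ} (hf : IsHarmonic f) :
    ∃ b, HasSlope f b := by
  have hedge : ∀ e, ∃ β : ℝ, ∀ t ∈ Icc 0 (G.len e),
      f (G.edgePt e t) = f (Point.vertex (G.src e) : G.Point) + β * t := by
    intro e
    have hl := G.len_pos e
    have hmid : G.len e / 2 ∈ Ioo 0 (G.len e) := ⟨by linarith, by linarith⟩
    -- The vanishing second derivative makes the derivative constant on the open edge; the midpoint
    -- is only a reference point. Continuity at the ends then extends the affine formula to the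
    -- closed edge.
    have hd : ∀ t ∈ Ioo 0 (G.len e),
        HasDerivAt (edgeFun f e) (deriv (edgeFun f e) (G.len e / 2)) t := by
      intro t ht
      have hconst : deriv (edgeFun f e) t = deriv (edgeFun f e) (G.len e / 2) :=
        isOpen_Ioo.is_const_of_deriv_eq_zero isPreconnected_Ioo
          (fun s hs => (hf.hasDerivAt_deriv e s hs).differentiableAt.differentiableWithinAt)
          (fun s hs => (hf.hasDerivAt_deriv e s hs).deriv) ht hmid
      rw [← hconst]
      exact ((hf.differentiableOn e).differentiableAt (Ioo_mem_nhds ht.1 ht.2)).hasDerivAt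
    have hcont : Continuous (edgeFun f e) := hf.continuous.comp (continuous_coe_edgePt e)
    refine ⟨deriv (edgeFun f e) (G.len e / 2), fun t ht => ?_⟩
    rw [← edgePt_zero]
    rcases ht.1.eq_or_lt with rfl | h0
    · simp
    obtain ⟨s, hs, h⟩ := exists_hasDerivAt_eq_slope (edgeFun f e)
      (fun _ => deriv (edgeFun f e) (G.len e / 2)) h0 hcont.continuousOn
      (fun s hs => hd s ⟨hs.1, hs.2.trans_le ht.2⟩)
    rw [sub_zero, eq_div_iff h0.ne'] at h
    simp only [edgeFun] at h ⊢
    linarith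
  choose b hb using hedge
  exact ⟨b, hb⟩

/-- The maximum principle applies to `f - g`, which is edgewise affine, satisfies the Kirchhoff
condition and vanishes on the boundary. Exchanging `f` and `g` gives uniqueness. -/
theorem IsHarmonic.le_of_eq_on_bdry [CompactSpace G.Compl] (hne : G.bdry.Nonempty)
    {f g : G.Compl → ℝ} (hf : IsHarmonic f) (hg : IsHarmonic g) (h : ∀ z ∈ G.bdry, f z = g z)
    (z : G.Compl) : f z ≤ g z := by
  obtain ⟨b, hb⟩ := hf.exists_hasSlope
  obtain ⟨b', hb'⟩ := hg.exists_hasSlope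
  refine sub_nonpos.1 ((hb.sub hb').nonpos_of_bdry (hf.continuous.sub hg.continuous) ?_ hne
    (fun z hz => sub_eq_zero.2 (h z hz)) z)
  intro v hv
  have h₁ := hf.kirchhoff v hv
  have h₂ := hg.kirchhoff v hv
  rw [hb.outwardDerivSum_eq] at h₁
  rw [hb'.outwardDerivSum_eq] at h₂
  simp only [Pi.sub_apply, Finset.sum_sub_distrib]
  linarith

/-! ### Edgewise affine extension of functions on the vertices -/

/-- The edgewise affine extension of a function on the vertices to the points of the graph. -/
noncomputable def affineExt (G : MetricGraph V E) (u : V → ℝ) : G.Point → ℝ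
  | .vertex v => u v
  | .inner e t _ => u (G.src e) + (u (G.tgt e) - u (G.src e)) / G.len e * t

theorem affineExt_edgePt (u : V → ℝ) (e : E) {t : ℝ} (ht : t ∈ Icc 0 (G.len e)) :
    G.affineExt u (G.edgePt e t) =
      u (G.src e) + (u (G.tgt e) - u (G.src e)) / G.len e * t := by
  rcases eq_endpoints_or_mem_Ioo_of_mem_Icc ht with rfl | rfl | h
  · simp [edgePt_zero, affineExt]
  · rw [edgePt_len, div_mul_cancel₀ _ (G.len_pos e).ne']
    simp [affineExt]
  · rw [edgePt_of_mem_Ioo e h]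
    rfl

/-- A function on the vertices that takes different values at the ends of only finitely many edges
extends to a continuous edgewise affine function of finite energy. -/
theorem exists_extension (u : V → ℝ) (hu : {e | u (G.tgt e) ≠ u (G.src e)}.Finite) :
    ∃ (f : G.Compl → ℝ) (y : lp (fun _ : E => ℝ) 2), Continuous f ∧
      HasSlope f (fun e => y e / √(G.len e)) ∧ (∀ v, f (Point.vertex v : G.Point) = u v) ∧
      ∀ e, y e = (u (G.tgt e) - u (G.src e)) / √(G.len e) := by
  -- Only finitely many slopes are nonzero, so they have a common bound. The affine extension is
  -- therefore Lipschitz on the graph and extends to the completion.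
  obtain ⟨M, hM⟩ : ∃ M : NNReal, ∀ e, ‖(u (G.tgt e) - u (G.src e)) / G.len e‖₊ ≤ M := by
    obtain ⟨M, hM⟩ := (hu.image fun e => ‖(u (G.tgt e) - u (G.src e)) / G.len e‖₊).bddAbove
    refine ⟨M, fun e => ?_⟩
    by_cases he : u (G.tgt e) = u (G.src e)
    · simp [he]
    · exact hM ⟨e, he, rfl⟩
  have hlip : LipschitzWith M (G.affineExt u) := by
    refine lipschitzWith_of_edges fun e s hs t ht => ?_
    rw [affineExt_edgePt u e hs, affineExt_edgePt u e ht, add_sub_add_left_eq_sub, ← mul_sub,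
      abs_mul]
    have : |(u (G.tgt e) - u (G.src e)) / G.len e| ≤ M := hM e
    gcongr
  have hext : ∀ x : G.Point, UniformSpace.Completion.extension (G.affineExt u) x =
      G.affineExt u x := fun x =>
    UniformSpace.Completion.extension_coe hlip.uniformContinuous x
  have hmem : Memℓp (fun e => (u (G.tgt e) - u (G.src e)) / √(G.len e)) 2 :=
    (memℓp_zero (hu.subset fun e he h => he (by simp [h]))).of_exponent_ge zero_le
  refine ⟨UniformSpace.Completion.extension (G.affineExt u), ⟨_, hmem⟩,
    UniformSpace.Completion.continuous_extension, fun e t ht => ?_, fun v => hext _, fun e => rfl⟩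
  rw [hext, hext, affineExt_edgePt u e ht]
  simp only [affineExt]
  rw [div_div, Real.mul_self_sqrt (G.len_pos e).le]

/-- The indicator function of a clopen part of the boundary extends to a continuous edgewise affine
function of finite energy. -/
theorem exists_extension_indicator [CompactSpace G.Compl] {P : Set G.bdry} (hP : IsClopen P) :
    ∃ (f : G.Compl → ℝ) (y : lp (fun _ : E => ℝ) 2), Continuous f ∧
      HasSlope f (fun e => y e / √(G.len e)) ∧
      ∀ z : G.bdry, f z = P.indicator (fun _ => (1 : ℝ)) z := by
  have hemb := (isClosed_bdry (G := G)).isClosedEmbedding_subtypeVal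
  obtain ⟨g, hg0, hg1, -⟩ := exists_continuous_zero_one_of_isClosed
    (hemb.isClosedMap _ hP.compl.isClosed) (hemb.isClosedMap _ hP.isClosed)
    (disjoint_image_of_injective Subtype.val_injective disjoint_compl_left)
  -- The map `s ↦ 3 * s - 1` sends `[1/3, 2/3]` onto `[0, 1]`, so after clamping `k` is `0` where `g
  -- < 1/3` and `1` where `g > 2/3`.
  set k : G.Compl → ℝ := fun z => max 0 (min 1 (3 * g z - 1)) with hk
  have hkc : Continuous k := by fun_prop
  set K : Set G.Compl := g ⁻¹' Icc (1 / 3) (2 / 3) with hKdef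
  have hKc : IsCompact K := (isClosed_Icc.preimage g.continuous).isCompact
  have hKb : Disjoint K G.bdry := by
    rw [disjoint_left]
    intro z hz hzb
    by_cases h : (⟨z, hzb⟩ : G.bdry) ∈ P
    · have : g z = 1 := hg1 ⟨⟨z, hzb⟩, h, rfl⟩
      rw [hKdef, mem_preimage, this] at hz
      norm_num at hz
    · have : g z = 0 := hg0 ⟨⟨z, hzb⟩, h, rfl⟩
      rw [hKdef, mem_preimage, this] at hz
      norm_num at hz
  have hS := finite_edges_of_isCompact hKc hKb
  set S := {e | ∃ t ∈ Icc 0 (G.len e), (G.edgePt e t : G.Compl) ∈ K} with hSdef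
  have hconst : ∀ e ∉ S, ∀ t ∈ Icc 0 (G.len e),
      k (G.edgePt e t) = k (Point.vertex (G.src e) : G.Point) := by
    intro e he t ht
    have hc : Continuous fun t => g (G.edgePt e t : G.Compl) :=
      g.continuous.comp (continuous_coe_edgePt e)
    have hsub : Icc 0 t ⊆ Icc 0 (G.len e) := Icc_subset_Icc_right ht.2
    have hno : ∀ s ∈ Icc 0 t, g (G.edgePt e s : G.Compl) < 1 / 3 ∨
        2 / 3 < g (G.edgePt e s : G.Compl) := by
      intro s hs
      by_contra! h
      exact he ⟨s, hsub hs, h⟩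
    -- An edge that misses `K` cannot pass from below `1/3` to above `2/3`, since it would attain
    -- `1/2`.
    have hmid : (1 / 2 : ℝ) ∉ (fun t => g (G.edgePt e t : G.Compl)) '' Icc 0 t := by
      rintro ⟨s, hs, h⟩
      simp only at h
      rcases hno s hs with h' | h' <;> linarith
    rw [← edgePt_zero]
    have h₀ := hno 0 (left_mem_Icc.2 ht.1)
    have h₁ := hno t (right_mem_Icc.2 ht.1)
    have hlow : ∀ z, g z < 1 / 3 → k z = 0 := fun z hz =>
      max_eq_left ((min_le_right _ _).trans (by linarith))
    have hhigh : ∀ z, 2 / 3 < g z → k z = 1 := fun z hz => by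
      simp only [hk]
      rw [min_eq_left (by linarith), max_eq_right zero_le_one]
    rcases h₀ with h₀ | h₀ <;> rcases h₁ with h₁ | h₁
    · rw [hlow _ h₀, hlow _ h₁]
    · exact absurd (intermediate_value_Icc ht.1 hc.continuousOn ⟨by linarith, by linarith⟩) hmid
    · exact absurd (intermediate_value_Icc' ht.1 hc.continuousOn ⟨by linarith, by linarith⟩) hmid
    · rw [hhigh _ h₀, hhigh _ h₁]
  have hktgt : ∀ e ∉ S, k (Point.vertex (G.tgt e) : G.Point) =
      k (Point.vertex (G.src e) : G.Point) := fun e he => by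
    rw [← hconst e he _ (right_mem_Icc.2 (G.len_pos e).le), edgePt_len]
  -- On the finitely many edges in `S`, `k` need be neither affine nor of finite energy.
  -- Interpolating its vertex values repairs this and leaves the other edges unchanged.
  obtain ⟨f, y, hfc, hfs, hfv, hy⟩ := exists_extension (G := G)
    (fun v => k (Point.vertex v : G.Point)) (hS.subset fun e he => by
      by_contra h
      exact he (hktgt e h))
  refine ⟨f, y, hfc, hfs, fun z => ?_⟩
  have hkz : k z = P.indicator (fun _ => (1 : ℝ)) z := by
    by_cases h : z ∈ P
    · have : g z = 1 := hg1 ⟨z, h, rfl⟩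
      rw [indicator_of_mem h, hk]
      simp only [this]
      norm_num
    · have : g z = 0 := hg0 ⟨z, h, rfl⟩
      rw [indicator_of_notMem h, hk]
      simp only [this]
      norm_num
  rw [← hkz, ← sub_eq_zero]
  -- The functions `f` and `k` agree at all vertices and off the compact union of the edges in `S`.
  refine eq_zero_on_bdry (h := fun z => f z - k z) (hfc.sub hkc)
    (K := ⋃ e ∈ S, G.edgePt e '' Icc 0 (G.len e))
    (hS.isCompact_biUnion fun e _ => isCompact_edge e) ?_ (fun v _ => by simp [hfv]) z.2
  intro x hx
  cases x with
  | vertex v => simp [hfv]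
  | inner e t ht =>
    have he : e ∉ S := fun he =>
      hx (mem_biUnion he ⟨t, Ioo_subset_Icc_self ht, edgePt_of_mem_Ioo e ht⟩)
    have h₁ := hfs e t (Ioo_subset_Icc_self ht)
    have h₂ := hconst e he t (Ioo_subset_Icc_self ht)
    rw [edgePt_of_mem_Ioo e ht] at h₁ h₂
    beta_reduce at h₁
    rw [h₁, h₂, hfv, hy, hktgt e he]
    simp

/-- The edgewise affine function that is `1` at the interior vertex `v` and `0` at all other
vertices. -/
theorem exists_tent {v : V} (hv : v ∉ G.bdryVertices) [DecidableEq V] :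
    ∃ (f : G.Compl → ℝ) (y : lp (fun _ : E => ℝ) 2), Continuous f ∧
      HasSlope f (fun e => y e / √(G.len e)) ∧ (∀ z ∈ G.bdry, f z = 0) ∧
      ∀ e, y e = ((if G.tgt e = v then 1 else 0) - (if G.src e = v then 1 else 0)) /
        √(G.len e) := by
  set S : Set E := {e | G.src e = v} ∪ {e | G.tgt e = v} with hSdef
  have hS : S.Finite := (G.finite_src v).union (G.finite_tgt v)
  obtain ⟨f, y, hfc, hfs, hfv, hy⟩ := exists_extension (G := G)
    (fun w => if w = v then 1 else 0) (hS.subset fun e he => by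
      by_contra h
      simp only [hSdef, mem_union, mem_ofPred_eq, not_or] at h
      exact he (by simp [h.1, h.2]))
  refine ⟨f, y, hfc, hfs, fun z hz => ?_, hy⟩
  -- By local finiteness the tent is supported on a compact union of edges; `v` is adjoined because
  -- no edge at `v` is assumed to exist.
  refine eq_zero_on_bdry hfc (K := {.vertex v} ∪ ⋃ e ∈ S, G.edgePt e '' Icc 0 (G.len e))
    (isCompact_singleton.union (hS.isCompact_biUnion fun e _ => isCompact_edge e)) ?_ ?_ hz
  · intro x hx
    cases x with
    | vertex w =>
      rw [hfv, if_neg]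
      rintro rfl
      exact hx (.inl rfl)
    | inner e t ht =>
      have he : e ∉ S := fun he =>
        hx (.inr (mem_biUnion he ⟨t, Ioo_subset_Icc_self ht, edgePt_of_mem_Ioo e ht⟩))
      simp only [hSdef, mem_union, mem_ofPred_eq, not_or] at he
      have h₁ := hfs e t (Ioo_subset_Icc_self ht)
      rw [edgePt_of_mem_Ioo e ht] at h₁
      beta_reduce at h₁
      rw [h₁, hfv, hy, if_neg he.1, if_neg he.2]
      simp
  · intro w hw
    rw [hfv, if_neg]
    rintro rfl
    exact hv hw

/-! ### Energy minimization -/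

/-- The weighted gradients of the continuous edgewise affine functions of finite energy that vanish
on the boundary. -/
def zeroBdryGradients (G : MetricGraph V E) : Submodule ℝ (lp (fun _ : E => ℝ) 2) where
  carrier := {y | ∃ f : G.Compl → ℝ, Continuous f ∧ HasSlope f (fun e => y e / √(G.len e)) ∧
    ∀ z ∈ G.bdry, f z = 0}
  zero_mem' := ⟨0, continuous_zero, fun e t _ => by simp, fun _ _ => rfl⟩
  add_mem' := by
    rintro y y' ⟨f, hf, hs, h0⟩ ⟨f', hf', hs', h0'⟩
    refine ⟨f + f', hf.add hf', (hs.add hs').congr ?_, fun z hz => by simp [h0 z hz, h0' z hz]⟩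
    ext e
    simp [add_div]
  smul_mem' := by
    rintro c y ⟨f, hf, hs, h0⟩
    refine ⟨c • f, hf.const_smul c, (hs.smul c).congr ?_, fun z hz => by simp [h0 z hz]⟩
    ext e
    simp [mul_div_assoc]

/-- All the functions vanish at a common boundary point, so the oscillation bound turns `ℓ²`
convergence of gradients into uniform convergence. The uniform limit is continuous with the limiting
slopes, and it still vanishes on the boundary. -/
theorem isClosed_zeroBdryGradients [CompactSpace G.Compl] (hne : G.bdry.Nonempty) :
    IsClosed (G.zeroBdryGradients : Set (lp (fun _ : E => ℝ) 2)) := by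
  refine IsSeqClosed.isClosed fun y y₀ hy hlim => ?_
  choose f hfc hfs hf0 using hy
  obtain ⟨z₀, hz₀⟩ := hne
  obtain ⟨D, hD⟩ : ∃ D, ∀ x y : G.Point, dist x y < D := by
    -- The bound must be strict, since paths of length equal to the distance need not exist.
    refine ⟨Metric.diam (univ : Set G.Compl) + 1, fun x y => lt_add_of_le_of_pos ?_ one_pos⟩
    rw [← UniformSpace.Completion.dist_eq]
    exact Metric.dist_le_diam_of_mem isCompact_univ.isBounded (mem_univ _) (mem_univ _)
  set F : ℕ → C(G.Compl, ℝ) := fun n => ⟨f n, hfc n⟩ with hF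
  have hdist : ∀ m n, dist (F m) (F n) ≤ √D * dist (y m) (y n) := by
    intro m n
    rw [ContinuousMap.dist_le (by positivity)]
    intro z
    have hs : HasSlope (f m - f n) fun e => (y m - y n) e / √(G.len e) :=
      ((hfs m).sub (hfs n)).congr (by ext e; simp [sub_div])
    have h := hs.abs_sub_le_norm_compl ((hfc m).sub (hfc n)) hD z z₀
    simpa [hF, hf0 m z₀ hz₀, hf0 n z₀ hz₀, Real.dist_eq, dist_eq_norm] using h
  have hcauchy : CauchySeq F := by
    rw [Metric.cauchySeq_iff]
    intro ε hε
    obtain ⟨N, hN⟩ := Metric.cauchySeq_iff.1 hlim.cauchySeq (ε / (√D + 1)) (by positivity)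
    refine ⟨N, fun m hm n hn => (hdist m n).trans_lt ?_⟩
    have h₁ := hN m hm n hn
    rw [lt_div_iff₀ (by positivity)] at h₁
    nlinarith [dist_nonneg (x := y m) (y := y n)]
  obtain ⟨F₀, hF₀⟩ := cauchySeq_tendsto_of_complete hcauchy
  have hpt : ∀ z, Filter.Tendsto (fun n => f n z) Filter.atTop (nhds (F₀ z)) := fun z =>
    ((continuous_eval_const z).tendsto F₀).comp hF₀
  have hyc : ∀ e, Filter.Tendsto (fun n => y n e) Filter.atTop (nhds (y₀ e)) := fun e => by
    refine tendsto_iff_norm_sub_tendsto_zero.2 ?_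
    refine squeeze_zero (fun _ => norm_nonneg _) (fun n => ?_)
      (tendsto_iff_norm_sub_tendsto_zero.1 hlim)
    exact lp.norm_apply_le_norm two_ne_zero (y n - y₀) e
  refine ⟨F₀, F₀.continuous, fun e t ht => ?_, fun z hz => ?_⟩
  · refine tendsto_nhds_unique (hpt _) ?_
    refine Filter.Tendsto.congr (fun n => (hfs n e t ht).symm) ?_
    exact (hpt _).add (((hyc e).div_const _).mul_const _)
  · exact tendsto_nhds_unique (hpt z) (by simp [hf0 _ z hz])

/-- The right side is minus the sum of the outward slopes at `v`. A loop at `v` contributes zero on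
both sides, as its two ends cancel. -/
theorem inner_tent [DecidableEq V] {v : V} (y y' : lp (fun _ : E => ℝ) 2)
    (hy' : ∀ e, y' e = ((if G.tgt e = v then 1 else 0) - (if G.src e = v then 1 else 0)) /
        √(G.len e)) :
    inner ℝ y y' = ∑ e ∈ (G.finite_tgt v).toFinset, y e / √(G.len e) -
      ∑ e ∈ (G.finite_src v).toFinset, y e / √(G.len e) := by
  have hsum : ∀ (p : E → V) (s : Finset E), (∀ e, e ∈ s ↔ p e = v) →
      HasSum (fun e => if p e = v then y e / √(G.len e) else 0) (∑ e ∈ s, y e / √(G.len e)) := by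
    intro p s hs
    rw [Finset.sum_congr rfl fun e he => (if_pos ((hs e).1 he)).symm]
    exact hasSum_sum_of_ne_finset_zero fun e he => if_neg fun h => he ((hs e).2 h)
  have h := (hsum G.tgt (G.finite_tgt v).toFinset (by simp)).sub
    (hsum G.src (G.finite_src v).toFinset (by simp))
  refine (lp.hasSum_inner y y').unique (h.congr_fun ?_)
  intro e
  rw [hy']
  split_ifs <;> simp <;> ring

/-- Every continuous edgewise affine function of finite energy has the same boundary values as some
harmonic function of finite energy. -/
theorem exists_finiteEnergyHarmonic [CompactSpace G.Compl] (hne : G.bdry.Nonempty)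
    {f : G.Compl → ℝ} {y : lp (fun _ : E => ℝ) 2} (hc : Continuous f)
    (hf : HasSlope f fun e => y e / √(G.len e)) :
    ∃ g ∈ G.finiteEnergyHarmonic, ∀ z ∈ G.bdry, g z = f z := by
  classical
  have : CompleteSpace G.zeroBdryGradients :=
    (isClosed_zeroBdryGradients hne).completeSpace_coe
  obtain ⟨f', hc', hf', h0⟩ : G.zeroBdryGradients.starProjection y ∈ G.zeroBdryGradients :=
    Submodule.starProjection_apply_mem _ _
  set y' := G.zeroBdryGradients.starProjection y with hy'
  -- Subtracting the projection leaves the boundary values unchanged and makes the gradient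
  -- orthogonal to all variations that vanish on the boundary.
  have horth : y - y' ∈ G.zeroBdryGradientsᗮ := Submodule.sub_starProjection_mem_orthogonal _
  have hs : HasSlope (f - f') fun e => (y - y') e / √(G.len e) :=
    (hf.sub hf').congr (by ext e; simp [sub_div])
  refine ⟨f - f', ⟨hs.isHarmonic (hc.sub hc') fun v hv => ?_, hs.memEnergySpace (hc.sub hc') ?_⟩,
    fun z hz => by simp [h0 z hz]⟩
  -- The tent at an interior vertex is an admissible variation; orthogonality to it is the Kirchhoff
  -- condition.
  · obtain ⟨φ, w, hφc, hφs, hφ0, hw⟩ := exists_tent hv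
    have h := Submodule.inner_left_of_mem_orthogonal (show w ∈ G.zeroBdryGradients from
      ⟨φ, hφc, hφs, hφ0⟩) horth
    rw [inner_tent _ _ hw] at h
    rw [hs.outwardDerivSum_eq]
    linarith
  · refine (lp.summable_inner (𝕜 := ℝ) (y - y') (y - y')).congr fun e => ?_
    rw [div_pow, Real.sq_sqrt (G.len_pos e).le, div_mul_cancel₀ _ (G.len_pos e).ne']
    simp [sq]

end MetricGraph

/-! ### The Dirichlet problem for step functions on the boundary -/

theorem theorem3p5 {V E : Type*} [Countable V] (G : MetricGraph V E)
    (hcompact : CompactSpace G.Compl)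
    (hdisc : IsTotallyDisconnected G.bdry)
    (hne : G.bdry.Nonempty)
    (N : ℕ) (P : Fin N → Set G.bdry)
    (hclopen : ∀ n, IsClopen (P n))
    (hdisj : Pairwise fun m n => Disjoint (P m) (P n))
    (hcover : ⋃ n, P n = Set.univ)
    (c : Fin N → ℝ) :
    ∃! f : G.Compl → ℝ, f ∈ G.finiteEnergyHarmonic ∧
      ∀ x : G.bdry, f x = ∑ n, c n * (P n).indicator (fun _ => (1 : ℝ)) x := by
  choose f y hfc hfs hfP using fun n => MetricGraph.exists_extension_indicator (hclopen n)
  have hslope : MetricGraph.HasSlope (∑ n, c n • f n)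
      fun e => (∑ n, c n • y n : lp (fun _ : E => ℝ) 2) e / √(G.len e) := by
    intro e t ht
    simp only [Finset.sum_apply, Pi.smul_apply, smul_eq_mul, lp.coeFn_sum, lp.coeFn_smul,
      Finset.sum_div, Finset.sum_mul, ← Finset.sum_add_distrib, hfs _ e t ht]
    exact Finset.sum_congr rfl fun n _ => by ring
  have hcont : Continuous (∑ n, c n • f n) :=
    (continuous_finsetSum _ fun n _ => (hfc n).const_smul (c n) :
      Continuous fun z => ∑ n, (c n • f n) z).congr fun z => (Finset.sum_apply z _ _).symm
  obtain ⟨g, hg, hgb⟩ := MetricGraph.exists_finiteEnergyHarmonic hne hcont hslope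
  have hgP : ∀ x : G.bdry, g x = ∑ n, c n * (P n).indicator (fun _ => (1 : ℝ)) x := fun x => by
    rw [hgb x x.2, Finset.sum_apply]
    exact Finset.sum_congr rfl fun n _ => by rw [Pi.smul_apply, hfP, smul_eq_mul]
  refine ⟨g, ⟨hg, hgP⟩, fun h hh => funext fun z => ?_⟩
  have heq : ∀ z ∈ G.bdry, h z = g z := fun z hz => (hh.2 ⟨z, hz⟩).trans (hgP ⟨z, hz⟩).symm
  exact le_antisymm (hh.1.1.le_of_eq_on_bdry hne hg.1 heq z)
    (hg.1.le_of_eq_on_bdry hne hh.1.1 (fun z hz => (heq z hz).symm) z)
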